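/- Let $\mathcal X$ be a compact metric space, $\mu$ a Borel probability measure on $\mathcal X$, and $f$ a (jointly measurable) zero-mean Gaussian process on $\mathcal X$ with continuous covariance $K:\mathcal X\times\mathcal X\to\mathbb R$. Let $\lambda_1\ge\lambda_2\ge\dots\ge 0$ be the positive eigenvalues, repeated according to multiplicity and followed by zeros if there are only finitely many, of the integral operator $\psi\mapsto\int_{\mathcal X}K(\cdot,t)\psi(t)\,d\mu(t)$ on $L^2(\mu)$. Let $M\ge 0$ and let $$y_m=f(x_m)+\nu_m,\qquad m=1,\dots,M,$$ where the input locations $x_m$ are i.i.d. with law $\mu$, the noises $\nu_m$ are i.i.d. $\mathcal N(0,\sigma^2)$ with $\sigma^2\ge 0$, and $f$, $\boldsymbol x=(x_1,\dots,x_M)$ and $(\nu_1,\dots,\nu_M)$ are mutually independent; put $\boldsymbol y=(y_1,\dots,y_M)$. **Theorem.** Let $E\ge 0$ be an integer, let $V\subset L^2(\mu)$ be any fixed (deterministic) $E$-dimensional linear subspace, and let $\widehat f_\star=\widehat f_\star(\boldsymbol x,\boldsymbol y)$ be any estimator of $f$ that is a measurable function of $(\boldsymbol x,\boldsymbol y)$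 with values in $V$. Then, almost surely, $$\mathbb E\bigl[\|f-\widehat f_\star\|^2\,\big|\,\boldsymbol x\bigr]\;\ge\;\sum_{e=E+1}^{\infty}\lambda_e,\qquad \|g\|^2=\int_{\mathcal X}g^2\,d\mu ,$$ where the conditional expectation takes values in $[0,\infty]$. -/

import Mathlib

open MeasureTheory ProbabilityTheory
open scoped ENNReal NNReal

/-- `lam 0 ≥ lam 1 ≥ …` is the list of the positive eigenvalues, repeated according to
multiplicity, of the integral operator `ψ ↦ ∫ K(·, t) ψ(t) dμ(t)` on `L²(μ)`, followed by zeros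
if there are only finitely many of them, and `phi e` (for `lam e > 0`) are the corresponding
eigenfunctions, orthonormal in `L²(μ)`. The entry of index `e` is the one that is written with
index `e + 1` when the numbering starts at `1`. Nothing is required of `phi e` when
`lam e = 0`. -/
structure IsKernelEigensystem {X : Type*} [MeasurableSpace X] (μ : Measure X)
    (K : X → X → ℝ) (lam : ℕ → ℝ) (phi : ℕ → X → ℝ) : Prop where
  antitone : Antitone lam
  nonneg : ∀ e, 0 ≤ lam e
  memLp : ∀ e, 0 < lam e → MemLp (phi e) 2 μ
  eigen : ∀ e, 0 < lam e → ∀ s, lam e * phi e s = ∫ t, K s t * phi e t ∂μ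
  orthonormal : ∀ i j, 0 < lam i → 0 < lam j →
    ∫ t, phi i t * phi j t ∂μ = if i = j then 1 else 0
  /-- No positive eigenvalue is missing, and none is listed too few times: an eigenfunction with
  a positive eigenvalue that is orthogonal to all the listed ones vanishes. -/
  exhaustive : ∀ (r : ℝ) (ψ : X → ℝ), 0 < r → MemLp ψ 2 μ →
    (∀ s, r * ψ s = ∫ t, K s t * ψ t ∂μ) →
    (∀ e, 0 < lam e → ∫ t, phi e t * ψ t ∂μ = 0) → ψ =ᵐ[μ] 0

/-- The measurement model: a zero-mean Gaussian process `f` on `X` with covariance `K`,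
i.i.d. input locations `x m` with law `μ`, i.i.d. noises `ν m` with law `N(0, σ2)`; the process,
the input locations and the noises are mutually independent. -/
structure IsGaussianRegressionModel {Ω X : Type*} [MeasurableSpace Ω] [MeasurableSpace X]
    (P : Measure Ω) (μ : Measure X) (K : X → X → ℝ) (σ2 : ℝ≥0) {M : ℕ}
    (f : X → Ω → ℝ) (x : Fin M → Ω → X) (ν : Fin M → Ω → ℝ) : Prop where
  measurable_process : Measurable (fun p : X × Ω => f p.1 p.2)
  gaussian_process : IsGaussianProcess f P
  mean_process : ∀ s, ∫ ω, f s ω ∂P = 0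
  cov_process : ∀ s t, covariance (f s) (f t) P = K s t
  measurable_input : ∀ m, Measurable (x m)
  law_input : ∀ m, HasLaw (x m) μ P
  indep_input : iIndepFun x P
  measurable_noise : ∀ m, Measurable (ν m)
  law_noise : ∀ m, HasLaw (ν m) (gaussianReal 0 σ2) P
  indep_noise : iIndepFun ν P
  /-- This field and the next one together: the three random objects `f` (as a random function),
  `x` and `ν` (as random vectors) are mutually independent. -/
  indep_process : IndepFun (fun ω s => f s ω) (fun ω => (fun m => x m ω, fun m => ν m ω)) P
  indep_input_noise : IndepFun (fun ω m => x m ω) (fun ω m => ν m ω) P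

/-- The measurements `y m = f (x m) + ν m`. -/
def measurements {Ω X : Type*} {M : ℕ}
    (f : X → Ω → ℝ) (x : Fin M → Ω → X) (ν : Fin M → Ω → ℝ) (ω : Ω) : Fin M → ℝ :=
  fun m => f (x m ω) ω + ν m ω

/-- The squared error `‖f - g‖² = ∫ (f - g)² dμ` between a function and an element of `L²(μ)`,
with value `∞` if the integral diverges. -/
noncomputable def sqError {X : Type*} [MeasurableSpace X] (μ : Measure X)
    (f : X → ℝ) (g : Lp ℝ 2 μ) : ℝ≥0∞ :=
  ∫⁻ t, ENNReal.ofReal ((f t - g t) ^ 2) ∂μ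

/-- `Err(x) = E[‖f - fhat(x, y)‖² | x]`, the conditional mean squared error of the estimator
`fhat` given the input locations: the conditional expectation, with values in `[0, ∞]`, given the
`σ`-algebra generated by `x`. -/
noncomputable def conditionalMSE {Ω X : Type*} [MeasurableSpace Ω] [MeasurableSpace X]
    (P : Measure Ω) (μ : Measure X) {M : ℕ}
    (f : X → Ω → ℝ) (x : Fin M → Ω → X) (ν : Fin M → Ω → ℝ)
    (fhat : (Fin M → X) × (Fin M → ℝ) → Lp ℝ 2 μ) : Ω → ℝ≥0∞ :=
  condLExp (MeasurableSpace.comap (fun ω m => x m ω) inferInstance) P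
    (fun ω => sqError μ (fun t => f t ω) (fhat (fun m => x m ω, measurements f x ν ω)))

/-! The estimator cannot touch the part of `f` orthogonal to `V`. In the span of the first `N`
eigenfunctions choose at least `N - E` orthonormal vectors orthogonal to `V`; by Bessel
(`ofReal_sum_sq_le_sqError`) the squared error is at least the sum of the squared components of `f`
along them, a quantity free of the estimator. Since `f` is independent of the inputs, its
eigencoefficients have second moments `lam i` on the diagonal and `0` off it even given `x`. The
conditional mean of the bound is thus a diagonal quadratic form, and Ky Fan's inequality bounds it
below by the sum of `lam i` over `E ≤ i < N`. Increasing `N` gives the tail sum. -/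

/-- Inside the span of `N` orthonormal vectors, the orthogonal complement of a subspace of
dimension `E` has dimension at least `N - E`; this gives the coordinates of an orthonormal
basis of it. -/
theorem exists_orthonormal_coords_orthogonal {H : Type*} [NormedAddCommGroup H]
    [InnerProductSpace ℝ H] {N : ℕ} (u : Fin N → H) (V : Submodule ℝ H) [FiniteDimensional ℝ V] :
    ∃ (k : ℕ) (a : Fin k → EuclideanSpace ℝ (Fin N)), Orthonormal ℝ a ∧
      N ≤ k + Module.finrank ℝ V ∧ ∀ j, ∀ g ∈ V, inner ℝ (∑ i, a j i • u i) g = 0 := by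
  -- Rank-nullity for coordinates ↦ projection onto `V`: the kernel consists of the combinations
  -- orthogonal to `V`.
  let L : EuclideanSpace ℝ (Fin N) →ₗ[ℝ] V :=
    (V.orthogonalProjectionOnto : H →ₗ[ℝ] V) ∘ₗ
      (Fintype.linearCombination ℝ u) ∘ₗ (WithLp.linearEquiv 2 ℝ (Fin N → ℝ)).toLinearMap
  let b := stdOrthonormalBasis ℝ (LinearMap.ker L)
  refine ⟨_, fun j => (b j : EuclideanSpace ℝ (Fin N)), ?_, ?_, ?_⟩
  · exact b.orthonormal.comp_linearIsometry (LinearMap.ker L).subtypeₗᵢ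
  · have h1 := L.finrank_range_add_finrank_ker
    have h2 := (LinearMap.range L).finrank_le
    rw [finrank_euclideanSpace_fin] at h1
    omega
  · intro j g hg
    have h : L (b j) = 0 := (b j).2
    have h' : V.orthogonalProjectionOnto (∑ i, (b j : EuclideanSpace ℝ (Fin N)) i • u i) = 0 := h
    rw [Submodule.orthogonalProjectionOnto_eq_zero_iff] at h'
    exact Submodule.inner_left_of_mem_orthogonal hg h'

/-- Ky Fan's inequality for a diagonal quadratic form. -/
theorem sum_Ico_le_sum_mul_sq_of_orthonormal {N k E : ℕ} {a : Fin k → EuclideanSpace ℝ (Fin N)}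
    (ha : Orthonormal ℝ a) (hN : N ≤ k + E) {lam : ℕ → ℝ} (hanti : Antitone lam)
    (hnonneg : ∀ e, 0 ≤ lam e) :
    ∑ i ∈ Finset.Ico E N, lam i ≤ ∑ j, ∑ i : Fin N, lam i * a j i ^ 2 := by
  rcases le_total N E with hNE | hEN
  · rw [Finset.Ico_eq_empty_of_le hNE, Finset.sum_empty]
    exact Finset.sum_nonneg fun j _ => Finset.sum_nonneg fun i _ =>
      mul_nonneg (hnonneg _) (sq_nonneg _)
  set q : Fin N → ℝ := fun i => ∑ j, a j i ^ 2 with hq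
  -- Bessel for a standard basis vector.
  have hq1 : ∀ i, q i ≤ 1 := fun i => by
    have := ha.sum_inner_products_le (EuclideanSpace.single i (1 : ℝ)) (s := Finset.univ)
    simpa [hq, EuclideanSpace.inner_single_right] using this
  have hq0 : ∀ i, 0 ≤ q i := fun i => Finset.sum_nonneg fun j _ => sq_nonneg _
  have hqsum : ∑ i, q i = k := by
    rw [hq, Finset.sum_comm]
    have : ∀ j, ∑ i, a j i ^ 2 = 1 := fun j => by
      have := EuclideanSpace.real_norm_sq_eq (a j)
      rw [← this, ha.1 j, one_pow]
    simp [this]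
  have hsum : ∑ i ∈ Finset.Ico E N, lam i = ∑ i : Fin N, if E ≤ (i : ℕ) then lam i else 0 := by
    rw [Fin.sum_univ_eq_sum_range (fun i => if E ≤ i then lam i else 0), ← Finset.sum_filter]
    congr 1
    ext i
    simp [and_comm]
  have hcard : ∑ i : Fin N, (if E ≤ (i : ℕ) then (1 : ℝ) else 0) = N - E := by
    rw [Fin.sum_univ_eq_sum_range (fun i => if E ≤ i then (1 : ℝ) else 0), ← Finset.sum_filter]
    have : (Finset.range N).filter (fun i => E ≤ i) = Finset.Ico E N := by
      ext i
      simp [and_comm]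
    rw [this]
    simp [Nat.cast_sub hEN]
  rw [hsum, Finset.sum_comm]
  simp_rw [← Finset.mul_sum]
  -- With threshold `lam E`, the factors `lam i - lam E` and `q i - 1_{E ≤ i}` never have opposite
  -- signs, so their product is nonnegative.
  have hterm : ∀ i : Fin N, lam E * (q i - if E ≤ (i : ℕ) then (1 : ℝ) else 0) ≤
      lam i * q i - if E ≤ (i : ℕ) then lam i else 0 := fun i => by
    split_ifs with h
    · nlinarith [hanti h, hq1 i]
    · nlinarith [hanti (not_le.mp h).le, hq0 i]
  have := Finset.sum_le_sum fun i (_ : i ∈ Finset.univ) => hterm i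
  rw [← Finset.mul_sum, Finset.sum_sub_distrib, Finset.sum_sub_distrib, hqsum, hcard] at this
  have hk : (0 : ℝ) ≤ k - (N - E) := by
    have : (N : ℝ) ≤ k + E := by exact_mod_cast hN
    linarith
  linarith [mul_nonneg (hnonneg E) hk]

theorem orthonormal_sum_smul {H : Type*} [NormedAddCommGroup H] [InnerProductSpace ℝ H]
    {ι κ : Type*} [Fintype ι] {u : ι → H} (hu : Orthonormal ℝ u)
    {a : κ → EuclideanSpace ℝ ι} (ha : Orthonormal ℝ a) :
    Orthonormal ℝ (fun j => ∑ i, a j i • u i) := by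
  classical
  rw [orthonormal_iff_ite] at ha ⊢
  intro j l
  rw [hu.inner_sum, ← ha j l, PiLp.inner_apply]
  simp [mul_comm]

/-- Bessel's inequality for the difference of a function and an element of a subspace, tested
against orthonormal vectors that are orthogonal to the subspace. -/
theorem ofReal_sum_sq_le_sqError {X : Type*} [MeasurableSpace X] {μ : Measure X}
    {V : Submodule ℝ (Lp ℝ 2 μ)} {N k : ℕ} {u : Fin N → X → ℝ} (hu : ∀ i, MemLp (u i) 2 μ)
    (horth : Orthonormal ℝ (fun i => (hu i).toLp (u i)))
    {a : Fin k → EuclideanSpace ℝ (Fin N)} (ha : Orthonormal ℝ a)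
    (haV : ∀ j, ∀ g ∈ V, inner ℝ (∑ i, a j i • (hu i).toLp (u i)) g = 0)
    {h : X → ℝ} (hh : AEStronglyMeasurable h μ) {g : Lp ℝ 2 μ} (hg : g ∈ V) :
    ENNReal.ofReal (∑ j, (∑ i, a j i * ∫ t, h t * u i t ∂μ) ^ 2) ≤ sqError μ h g := by
  -- If the error is finite, `h = (h - g) + g` is itself in `L²`.
  by_cases htop : sqError μ h g = ∞
  · simp [htop]
  have hgm : MemLp g 2 μ := Lp.memLp g
  have hint : Integrable (fun t => (h t - g t) ^ 2) μ := by
    refine ⟨(hh.sub hgm.1).pow 2, ?_⟩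
    rw [hasFiniteIntegral_iff_ofReal (ae_of_all _ fun t => sq_nonneg _)]
    exact lt_top_iff_ne_top.mpr htop
  have hsub : MemLp (h - (g : X → ℝ)) 2 μ := (memLp_two_iff_integrable_sq (hh.sub hgm.1)).mpr hint
  have hhm : MemLp h 2 μ := by simpa using hsub.add hgm
  have herr : sqError μ h g = ENNReal.ofReal (‖hhm.toLp h - g‖ ^ 2) := by
    rw [sqError, ← ofReal_integral_eq_lintegral_ofReal hint (ae_of_all _ fun t => sq_nonneg _),
      ← real_inner_self_eq_norm_sq, L2.inner_def]
    congr 1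
    refine integral_congr_ae ?_
    filter_upwards [Lp.coeFn_sub (hhm.toLp h) g, hhm.coeFn_toLp] with t h1 h2
    rw [Pi.sub_apply, h2] at h1
    rw [h1, sq]
    rfl
  have hinner : ∀ i, inner ℝ ((hu i).toLp (u i)) (hhm.toLp h) = ∫ t, h t * u i t ∂μ := fun i => by
    rw [L2.inner_def]
    refine integral_congr_ae ?_
    filter_upwards [(hu i).coeFn_toLp, hhm.coeFn_toLp] with t h1 h2
    simp [h1, h2]
  rw [herr]
  refine ENNReal.ofReal_le_ofReal ?_
  have hb := (orthonormal_sum_smul horth ha).sum_inner_products_le (hhm.toLp h - g)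
    (s := Finset.univ)
  refine le_trans (le_of_eq ?_) hb
  refine Finset.sum_congr rfl fun j _ => ?_
  rw [inner_sub_right, haV j g hg, sub_zero, sum_inner, Real.norm_eq_abs, sq_abs]
  simp_rw [real_inner_smul_left, hinner]

/-! ### Second moments of the process given the inputs -/

section Regression

variable {Ω X : Type*} [MeasurableSpace Ω] [MeasurableSpace X] {P : Measure Ω} {μ : Measure X}
  {K : X → X → ℝ} {σ2 : ℝ≥0} {M : ℕ} {f : X → Ω → ℝ} {x : Fin M → Ω → X} {ν : Fin M → Ω → ℝ}

namespace IsGaussianRegressionModel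

theorem memLp_eval (h : IsGaussianRegressionModel P μ K σ2 f x ν) (s : X) : MemLp (f s) 2 P :=
  (h.gaussian_process.hasGaussianLaw_eval s).memLp_two

theorem integrable_mul_eval (h : IsGaussianRegressionModel P μ K σ2 f x ν) (s t : X) :
    Integrable (fun ω => f s ω * f t ω) P :=
  (h.memLp_eval s).integrable_mul (h.memLp_eval t)

theorem measurable_inputs (h : IsGaussianRegressionModel P μ K σ2 f x ν) :
    Measurable (fun ω m => x m ω) :=
  measurable_pi_lambda _ h.measurable_input

variable [IsProbabilityMeasure P]

theorem integral_mul_eval (h : IsGaussianRegressionModel P μ K σ2 f x ν) (s t : X) :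
    ∫ ω, f s ω * f t ω ∂P = K s t := by
  rw [← h.cov_process s t, covariance_eq_sub (h.memLp_eval s) (h.memLp_eval t),
    h.mean_process s, zero_mul, sub_zero]
  rfl

/-- Second moments of the process are not changed by conditioning on the input locations. -/
theorem setIntegral_mul_eval (h : IsGaussianRegressionModel P μ K σ2 f x ν) (s t : X) {A : Set Ω}
    (hA : MeasurableSet[MeasurableSpace.comap (fun ω m => x m ω) inferInstance] A) :
    ∫ ω in A, f s ω * f t ω ∂P = P.real A * K s t := by
  obtain ⟨B, hB, rfl⟩ := hA
  have hind : IndepFun (fun ω => f s ω * f t ω)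
      (fun ω => B.indicator (fun _ => (1 : ℝ)) (fun m => x m ω)) P :=
    h.indep_process.comp (φ := fun g : X → ℝ => g s * g t)
      (ψ := fun p : (Fin M → X) × (Fin M → ℝ) => B.indicator (fun _ => (1 : ℝ)) p.1)
      (by fun_prop) ((measurable_const.indicator hB).comp measurable_fst)
  have hm : MeasurableSet ((fun ω m => x m ω) ⁻¹' B) := h.measurable_inputs hB
  have hmul := hind.integral_fun_mul_eq_mul_integral
    (h.integrable_mul_eval s t).aestronglyMeasurable
    ((measurable_const.indicator hB).comp h.measurable_inputs).aestronglyMeasurable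
  have hone : ∫ ω, B.indicator (fun _ => (1 : ℝ)) (fun m => x m ω) ∂P =
      P.real ((fun ω m => x m ω) ⁻¹' B) := by
    rw [← integral_indicator_one hm]
    rfl
  rw [hone, h.integral_mul_eval, mul_comm] at hmul
  rw [← hmul, ← integral_indicator hm]
  congr 1
  ext ω
  by_cases hω : (fun m => x m ω) ∈ B <;> simp [Set.indicator, hω]

/-- From `|ab| ≤ (a² + b²) / 2`; the bound is uniform in `s` and `t`, as domination in Fubini
requires. -/
theorem integral_abs_mul_eval_le (h : IsGaussianRegressionModel P μ K σ2 f x ν) {C : ℝ}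
    (hC : ∀ s, K s s ≤ C) (s t : X) : ∫ ω, |f s ω * f t ω| ∂P ≤ C := by
  have h1 : ∫ ω, |f s ω * f t ω| ∂P ≤ ∫ ω, (f s ω * f s ω + f t ω * f t ω) / 2 ∂P := by
    refine integral_mono (h.integrable_mul_eval s t).abs
      (((h.integrable_mul_eval s s).add (h.integrable_mul_eval t t)).div_const 2) fun ω => ?_
    simp only [abs_mul]
    nlinarith [sq_nonneg (|f s ω| - |f t ω|), abs_mul_abs_self (f s ω), abs_mul_abs_self (f t ω)]
  rw [integral_div, integral_add (h.integrable_mul_eval s s) (h.integrable_mul_eval t t),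
    h.integral_mul_eval, h.integral_mul_eval] at h1
  linarith [hC s, hC t]

variable [MetricSpace X] [CompactSpace X] [BorelSpace X] [IsProbabilityMeasure μ]

/-- Justifies Fubini: compactness bounds `K` on the diagonal by some `C`, so integrating out `ω`
leaves at most `C |φ| |ψ|`. -/
theorem integrable_prod_mul (h : IsGaussianRegressionModel P μ K σ2 f x ν)
    (hK : Continuous (fun p : X × X => K p.1 p.2)) {φ ψ : X → ℝ}
    (hφ : Integrable φ μ) (hψ : Integrable ψ μ) :
    Integrable (fun p : Ω × X × X => (f p.2.1 p.1 * φ p.2.1) * (f p.2.2 p.1 * ψ p.2.2))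
      (P.prod (μ.prod μ)) := by
  obtain ⟨C, hC⟩ : ∃ C, ∀ s, K s s ≤ C := by
    obtain ⟨C, hC⟩ := isCompact_univ.bddAbove_image
      (f := fun s => K s s) (hK.comp (continuous_id.prodMk continuous_id)).continuousOn
    exact ⟨C, fun s => hC ⟨s, Set.mem_univ s, rfl⟩⟩
  have hf1 : Measurable (fun p : Ω × X × X => f p.2.1 p.1) :=
    h.measurable_process.comp (by fun_prop : Measurable fun p : Ω × X × X => (p.2.1, p.1))
  have hf2 : Measurable (fun p : Ω × X × X => f p.2.2 p.1) :=
    h.measurable_process.comp (by fun_prop : Measurable fun p : Ω × X × X => (p.2.2, p.1))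
  have hm : AEStronglyMeasurable
      (fun p : Ω × X × X => (f p.2.1 p.1 * φ p.2.1) * (f p.2.2 p.1 * ψ p.2.2))
      (P.prod (μ.prod μ)) :=
    (hf1.aestronglyMeasurable.mul hφ.1.comp_fst.comp_snd).mul
      (hf2.aestronglyMeasurable.mul hψ.1.comp_snd.comp_snd)
  rw [integrable_prod_iff' hm]
  constructor
  · refine ae_of_all _ fun z => ?_
    refine ((h.integrable_mul_eval z.1 z.2).mul_const (φ z.1 * ψ z.2)).congr (ae_of_all _ fun ω => ?_)
    ring
  · refine ((hφ.abs.mul_prod hψ.abs).const_mul C).mono' hm.norm.prod_swap.integral_prod_right' ?_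
    refine ae_of_all _ fun z => ?_
    rw [Real.norm_of_nonneg (integral_nonneg fun ω => norm_nonneg _)]
    have : ∀ ω, ‖(f z.1 ω * φ z.1) * (f z.2 ω * ψ z.2)‖ =
        |f z.1 ω * f z.2 ω| * (|φ z.1| * |ψ z.2|) := fun ω => by
      simp only [norm_mul, Real.norm_eq_abs, abs_mul]
      ring
    simp_rw [this]
    rw [integral_mul_const]
    exact mul_le_mul_of_nonneg_right (h.integral_abs_mul_eval_le hC _ _) (by positivity)

theorem integrable_coeff_mul (h : IsGaussianRegressionModel P μ K σ2 f x ν)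
    (hK : Continuous (fun p : X × X => K p.1 p.2)) {φ ψ : X → ℝ}
    (hφ : Integrable φ μ) (hψ : Integrable ψ μ) :
    Integrable (fun ω => (∫ t, f t ω * φ t ∂μ) * ∫ t, f t ω * ψ t ∂μ) P := by
  refine (h.integrable_prod_mul hK hφ hψ).integral_prod_left.congr (ae_of_all _ fun ω => ?_)
  exact integral_prod_mul (fun s => f s ω * φ s) (fun t => f t ω * ψ t)

/-- Second moments of the coefficients of the process, conditionally on the input locations. -/
theorem setIntegral_coeff_mul (h : IsGaussianRegressionModel P μ K σ2 f x ν)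
    (hK : Continuous (fun p : X × X => K p.1 p.2)) {φ ψ : X → ℝ}
    (hφ : Integrable φ μ) (hψ : Integrable ψ μ) {A : Set Ω}
    (hA : MeasurableSet[MeasurableSpace.comap (fun ω m => x m ω) inferInstance] A) :
    ∫ ω in A, (∫ t, f t ω * φ t ∂μ) * (∫ t, f t ω * ψ t ∂μ) ∂P =
      P.real A * ∫ s, φ s * ∫ t, K s t * ψ t ∂μ ∂μ := by
  have hint : Integrable (fun p : Ω × X × X => (f p.2.1 p.1 * φ p.2.1) * (f p.2.2 p.1 * ψ p.2.2))
      ((P.restrict A).prod (μ.prod μ)) :=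
    (h.integrable_prod_mul hK hφ hψ).mono_measure
      (Measure.prod_mono Measure.restrict_le_self le_rfl)
  have hinner : ∀ z : X × X, ∫ ω in A, (f z.1 ω * φ z.1) * (f z.2 ω * ψ z.2) ∂P =
      P.real A * (φ z.1 * (K z.1 z.2 * ψ z.2)) := fun z => by
    have : ∀ ω, (f z.1 ω * φ z.1) * (f z.2 ω * ψ z.2) =
        (f z.1 ω * f z.2 ω) * (φ z.1 * ψ z.2) := fun ω => by ring
    simp_rw [this]
    rw [integral_mul_const, h.setIntegral_mul_eval _ _ hA]
    ring
  simp_rw [← integral_prod_mul (μ := μ) (ν := μ)]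
  rw [integral_integral_swap
    (f := fun ω (z : X × X) => (f z.1 ω * φ z.1) * (f z.2 ω * ψ z.2)) hint]
  have hK' := hint.integral_prod_right
  simp_rw [hinner] at hK' ⊢
  rw [integral_prod _ hK']
  simp_rw [integral_const_mul]

end IsGaussianRegressionModel

variable [IsProbabilityMeasure P] [MetricSpace X] [CompactSpace X] [BorelSpace X]
  [IsProbabilityMeasure μ]

/-- The eigenvalue equation replaces the inner kernel integral by `lam j * phi j`; orthonormality
does the rest. -/
theorem IsKernelEigensystem.setIntegral_coeff_mul {lam : ℕ → ℝ} {phi : ℕ → X → ℝ}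
    (heig : IsKernelEigensystem μ K lam phi) (h : IsGaussianRegressionModel P μ K σ2 f x ν)
    (hK : Continuous (fun p : X × X => K p.1 p.2)) {i j : ℕ} (hi : 0 < lam i) (hj : 0 < lam j)
    {A : Set Ω} (hA : MeasurableSet[MeasurableSpace.comap (fun ω m => x m ω) inferInstance] A) :
    ∫ ω in A, (∫ t, f t ω * phi i t ∂μ) * (∫ t, f t ω * phi j t ∂μ) ∂P =
      P.real A * if i = j then lam j else 0 := by
  rw [h.setIntegral_coeff_mul hK ((heig.memLp i hi).integrable one_le_two)
    ((heig.memLp j hj).integrable one_le_two) hA]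
  simp_rw [← heig.eigen j hj, mul_left_comm _ (lam j)]
  rw [integral_const_mul, heig.orthonormal i j hi hj]
  simp

theorem sum_Ico_le_conditionalMSE {lam : ℕ → ℝ} {phi : ℕ → X → ℝ}
    (heig : IsKernelEigensystem μ K lam phi) (h : IsGaussianRegressionModel P μ K σ2 f x ν)
    (hK : Continuous (fun p : X × X => K p.1 p.2))
    (V : Submodule ℝ (Lp ℝ 2 μ)) [FiniteDimensional ℝ V]
    (fhat : (Fin M → X) × (Fin M → ℝ) → Lp ℝ 2 μ) (hfhatV : ∀ d, fhat d ∈ V)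
    {N : ℕ} (hN : ∀ i < N, 0 < lam i) :
    ∀ᵐ ω ∂P, ENNReal.ofReal (∑ i ∈ Finset.Ico (Module.finrank ℝ V) N, lam i) ≤
      conditionalMSE P μ f x ν fhat ω := by
  have hpos : ∀ i : Fin N, 0 < lam i := fun i => hN i i.2
  have hu : ∀ i : Fin N, MemLp (phi i) 2 μ := fun i => heig.memLp i (hpos i)
  have horth : Orthonormal ℝ (fun i => (hu i).toLp (phi i)) := by
    rw [orthonormal_iff_ite]
    intro i j
    have hij : (if i = j then (1 : ℝ) else 0) = if (i : ℕ) = j then 1 else 0 := by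
      simp [Fin.ext_iff]
    rw [hij, ← heig.orthonormal i j (hpos i) (hpos j), L2.inner_def]
    refine integral_congr_ae ?_
    filter_upwards [(hu i).coeFn_toLp, (hu j).coeFn_toLp] with t h1 h2
    simp [h1, h2, mul_comm]
  obtain ⟨k, a, ha, hk, haV⟩ :=
    exists_orthonormal_coords_orthogonal (fun i => (hu i).toLp (phi i)) V
  set F : Fin N → Ω → ℝ := fun i ω => ∫ t, f t ω * phi i t ∂μ with hF
  set D : Ω → ℝ := fun ω => ∑ j, (∑ i, a j i * F i ω) ^ 2 with hD
  set S : ℝ := ∑ j, ∑ i : Fin N, lam i * a j i ^ 2 with hS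
  have hDeq : D = fun ω => ∑ j, ∑ i, ∑ l, (a j i * a j l) * (F i ω * F l ω) := by
    ext ω
    simp only [hD, sq, Finset.sum_mul_sum]
    refine Finset.sum_congr rfl fun j _ => Finset.sum_congr rfl fun i _ =>
      Finset.sum_congr rfl fun l _ => by ring
  have hFint : ∀ i l, Integrable (fun ω => F i ω * F l ω) P := fun i l =>
    h.integrable_coeff_mul hK ((hu i).integrable one_le_two) ((hu l).integrable one_le_two)
  have hterm : ∀ j i l, Integrable (fun ω => (a j i * a j l) * (F i ω * F l ω)) P := fun j i l =>
    (hFint i l).const_mul _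
  have hDint : Integrable D P := by
    rw [hDeq]
    exact integrable_finsetSum _ fun j _ => integrable_finsetSum _ fun i _ =>
      integrable_finsetSum _ fun l _ => hterm j i l
  have hDset : ∀ A, MeasurableSet[MeasurableSpace.comap (fun ω m => x m ω) inferInstance] A →
      ∫ ω in A, D ω ∂P = P.real A * S := fun A hA => by
    rw [hDeq, integral_finsetSum _ fun j _ => (integrable_finsetSum _ fun i _ =>
      integrable_finsetSum _ fun l _ => hterm j i l).integrableOn, hS, Finset.mul_sum]
    refine Finset.sum_congr rfl fun j _ => ?_
    rw [integral_finsetSum _ fun i _ =>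
      (integrable_finsetSum _ fun l _ => hterm j i l).integrableOn, Finset.mul_sum]
    refine Finset.sum_congr rfl fun i _ => ?_
    rw [integral_finsetSum _ fun l _ => (hterm j i l).integrableOn]
    simp_rw [integral_const_mul, hF, heig.setIntegral_coeff_mul h hK (hpos _) (hpos _) hA,
      ← Fin.ext_iff]
    rw [Finset.sum_eq_single i (fun l _ hl => by simp [hl.symm]) (by simp)]
    simp
    ring
  have hm := h.measurable_inputs.comap_le
  -- `D` integrates to `P A * S` over every event `A` determined by `x`, which identifies its
  -- conditional expectation as the constant `S`.
  have hcond : (fun _ => ENNReal.ofReal S) =ᵐ[P]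
      condLExp (MeasurableSpace.comap (fun ω m => x m ω) inferInstance) P
        (fun ω => ENNReal.ofReal (D ω)) := by
    refine ae_eq_condLExp hm P _ measurable_const fun A hA => ?_
    rw [← ofReal_integral_eq_lintegral_ofReal hDint.integrableOn
      (ae_of_all _ fun ω => Finset.sum_nonneg fun j _ => sq_nonneg _), hDset A hA,
      ENNReal.ofReal_mul measureReal_nonneg, setLIntegral_const, ofReal_measureReal, mul_comm]
  have hle : (fun ω => ENNReal.ofReal (D ω)) ≤ᵐ[P]
      fun ω => sqError μ (fun t => f t ω) (fhat (fun m => x m ω, measurements f x ν ω)) :=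
    ae_of_all _ fun ω => ofReal_sum_sq_le_sqError hu horth ha haV
      (h.measurable_process.comp measurable_prodMk_right).aestronglyMeasurable (hfhatV _)
  filter_upwards [hcond, condLExp_mono
    (mΩ := MeasurableSpace.comap (fun ω m => x m ω) inferInstance) hle] with ω h1 h2
  refine le_trans (ENNReal.ofReal_le_ofReal
    (sum_Ico_le_sum_mul_sq_of_orthonormal ha hk heig.antitone heig.nonneg)) ?_
  exact h1.trans_le h2

end Regression

theorem mainTheorem4 {Ω X : Type*} [MeasurableSpace Ω]
    [MetricSpace X] [CompactSpace X] [MeasurableSpace X] [BorelSpace X]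
    (P : Measure Ω) [IsProbabilityMeasure P] (μ : Measure X) [IsProbabilityMeasure μ]
    (K : X → X → ℝ) (hK : Continuous (fun p : X × X => K p.1 p.2))
    (lam : ℕ → ℝ) (phi : ℕ → X → ℝ) (heig : IsKernelEigensystem μ K lam phi)
    (σ2 : ℝ≥0) (M : ℕ)
    (f : X → Ω → ℝ) (x : Fin M → Ω → X) (ν : Fin M → Ω → ℝ)
    (hmodel : IsGaussianRegressionModel P μ K σ2 f x ν)
    (E : ℕ) (V : Submodule ℝ (Lp ℝ 2 μ)) [FiniteDimensional ℝ V]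
    (hV : Module.finrank ℝ V = E)
    (fhat : (Fin M → X) × (Fin M → ℝ) → Lp ℝ 2 μ)
    (hfhat : StronglyMeasurable fhat) (hfhatV : ∀ d, fhat d ∈ V) :
    ∀ᵐ ω ∂P, ∑' e : ℕ, ENNReal.ofReal (lam (E + e)) ≤ conditionalMSE P μ f x ν fhat ω := by
  subst hV
  have key : ∀ n : ℕ, ∀ᵐ ω ∂P,
      ∑ e ∈ Finset.range n, ENNReal.ofReal (lam (Module.finrank ℝ V + e)) ≤
        conditionalMSE P μ f x ν fhat ω := fun n => by
    -- A zero eigenvalue leaves the partial sum unchanged; a positive one forces all earlier ones to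
    -- be positive, so their eigenfunctions are available and the finite bound applies.
    induction n with
    | zero => simp
    | succ n ih =>
      rcases (heig.nonneg (Module.finrank ℝ V + n)).eq_or_lt with h0 | hpos
      · simpa [Finset.sum_range_succ, ← h0] using ih
      · filter_upwards [sum_Ico_le_conditionalMSE heig hmodel hK V fhat hfhatV
          (N := Module.finrank ℝ V + (n + 1))
          fun i hi => hpos.trans_le (heig.antitone (by omega))] with ω hω
        rwa [Finset.sum_Ico_eq_sum_range, Nat.add_sub_cancel_left,
          ENNReal.ofReal_sum_of_nonneg fun i _ => heig.nonneg _] at hω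
  filter_upwards [ae_all_iff.mpr key] with ω hω
  rw [ENNReal.tsum_eq_iSup_nat]
  exact iSup_le hω
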